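/- Let $\lambda_1,P_1,T_I,T_E>0$ and $\alpha>2$. Let $\Phi_1=\{(x,t_x)\}$ be a homogeneous Poisson point process of intensity $\lambda_1$ on $\mathbb{R}^2\times\mathbb{R}$, where $x$ is the location of a transmitter and $t_x$ the time at which it starts a transmission of duration $T_I$. Attach to the points of $\Phi_1$ i.i.d. exponential random variables $h_x$ with mean $1$, independent of $\Phi_1$. Put $\phi(t,s)=\mathbf{1}(s\le t\le s+T_I)$ and define $$y(t)=P_1\sum_{(x,t_x)\in\Phi_1}\phi(t,t_x)\,h_x\,(1+\|x\|^\alpha)^{-1},\qquad E_H=\int_0^{T_E}y(t)\,dt .$$ Then almost surely the sum converges for every $t\in[0,T_E]$ and $y$ is integrable on $[0,T_E]$, so that $E_H$ is a well-defined random variable, and for every $z\in\mathbb{R}$ its characteristic function $\mathcal{F}(z)=\mathbb{E}[e^{\imath zE_H}]$ is $$\mathcal{F}(z)=\exp\left(2\pi\lambda_1\int_{-T_I}^{T_E}\int_0^\infty\frac{\imath zP_1\psi(t)\,u}{1+u^\alpha-\imath zP_1\psi(t)}\,du\,dt\right),$$ with convergent integrals. Here $\psi(t)=\int_0^{T_E}\phi(\tau,t)\,d\tau$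 is the length of $[t,t+T_I]\cap[0,T_E]$; it vanishes outside $(-T_I,T_E)$, and on this interval it is given as follows. - If $T_E>T_I$: $\psi(t)=T_I+t$ for $-T_I<t\le 0$; $\psi(t)=T_I$ for $0<t\le T_E-T_I$; $\psi(t)=T_E-t$ for $T_E-T_I<t<T_E$. - If $T_E=T_I$: $\psi(t)=T_I+t$ for $-T_I<t<0$; $\psi(0)=T_I$; $\psi(t)=T_I-t$ for $0<t<T_I$. - If $T_E<T_I$: $\psi(t)=T_I+t$ for $-T_I<t\le T_E-T_I$; $\psi(t)=T_E$ for $T_E-T_I<t\le 0$; $\psi(t)=T_E-t$ for $0<t<T_E$. -/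

import Mathlib

open MeasureTheory ProbabilityTheory Set

noncomputable section

/-- Space-time: a point `(x, s)` is a location `x` in the Euclidean plane together with a time `s`. -/
abbrev SpaceTime : Type := EuclideanSpace ℝ (Fin 2) × ℝ

/-- The number of indices `i` such that the point `X i` lies in `B`. -/
def pointCount {S : Type*} (X : ℕ → S) (B : Set S) : ℕ∞ := {i : ℕ | X i ∈ B}.encard

/-- The random points `X 0, X 1, …` enumerate a Poisson point process with intensity measure `Λ`:
the number of points in a measurable set `B` of finite intensity is Poisson distributed with
mean `Λ B`, and the numbers of points in disjoint such sets are independent.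
(A Poisson process of infinite total intensity almost surely has infinitely many points, so that
an enumeration by `ℕ` is the right notion for it.) -/
structure IsPoissonProcess {Ω : Type*} [MeasurableSpace Ω] {S : Type*} [MeasurableSpace S]
    (X : ℕ → Ω → S) (Λ : Measure S) (P : Measure Ω) : Prop where
  measurable : ∀ i, Measurable (X i)
  count_law : ∀ B : Set S, MeasurableSet B → Λ B ≠ ⊤ → ∀ k : ℕ,
    P {ω | pointCount (fun i => X i ω) B = (k : ℕ∞)} = poissonMeasure (Λ B).toNNReal {k}
  count_indep : ∀ (n : ℕ) (B : Fin n → Set S), (∀ j, MeasurableSet (B j)) →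
    (∀ j, Λ (B j) ≠ ⊤) → Pairwise (fun j k => Disjoint (B j) (B k)) →
    iIndepFun (fun j ω => pointCount (fun i => X i ω) (B j)) P

/-- `φ(t, s) = 1(s ≤ t ≤ s + T_I)`: whether a transmission of duration `T_I` started at time `s`
is active at time `t`. -/
def activity (T_I t s : ℝ) : ℝ := (Icc s (s + T_I)).indicator (fun _ => 1) t

/-- The contribution `φ(t, s) h (1 + ‖x‖ ^ α)⁻¹` at time `t` of one transmitter `p = (x, s)` with
channel coefficient `h` to the power received at the origin, per unit of transmit power. -/
def receivedGain (α T_I : ℝ) (p : SpaceTime) (h t : ℝ) : ℝ :=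
  activity T_I t p.2 * h * (1 + ‖p.1‖ ^ α)⁻¹

/-- The power `y(t)` available for harvesting at the origin at time `t`, for the transmitters `X i`
with channel coefficients `h i`. -/
def incidentPower (P₁ α T_I : ℝ) (X : ℕ → SpaceTime) (h : ℕ → ℝ) (t : ℝ) : ℝ :=
  P₁ * ∑' i, receivedGain α T_I (X i) (h i) t

/-- The energy `E_H = ∫₀^{T_E} y(t) dt` harvested at the origin during `[0, T_E]`. -/
def harvestedEnergy (P₁ α T_I T_E : ℝ) (X : ℕ → SpaceTime) (h : ℕ → ℝ) : ℝ :=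
  ∫ t in (0 : ℝ)..T_E, incidentPower P₁ α T_I X h t

/-- The function `ψ` on `(-T_I, T_E)`, extended by zero. -/
def psi (T_I T_E t : ℝ) : ℝ :=
  if T_I < T_E then
    if -T_I < t ∧ t ≤ 0 then T_I + t
    else if 0 < t ∧ t ≤ T_E - T_I then T_I
    else if T_E - T_I < t ∧ t < T_E then T_E - t
    else 0
  else if T_E = T_I then
    if -T_I < t ∧ t < 0 then T_I + t
    else if 0 < t ∧ t < T_I then T_I - t
    else if t = 0 then T_I
    else 0
  else
    if -T_I < t ∧ t ≤ T_E - T_I then T_I + t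
    else if T_E - T_I < t ∧ t ≤ 0 then T_E
    else if 0 < t ∧ t < T_E then T_E - t
    else 0

/-- The integrand `ı z P₁ ψ(t) u / (1 + u ^ α - ı z P₁ ψ(t))`. -/
def charIntegrand (P₁ α T_I T_E z t u : ℝ) : ℂ :=
  Complex.I * (z * P₁ * psi T_I T_E t * u : ℝ) /
    (((1 + u ^ α : ℝ) : ℂ) - Complex.I * (z * P₁ * psi T_I T_E t : ℝ))

end

open Filter Topology

/-! Exchanging sum and time integral writes the energy as `∑ w(X i) * h i` with `w(x, s) = P₁ ψ(s) /
(1 + ‖x‖ ^ α)`. Averaging over the exponential marks turns the characteristic function of a partial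
sum into the expectation of a finite product of `g(X i)`, where `g = 1 / (1 - ı z w)`. The
generating functional `IsPoissonProcess.tendsto_integral_prod` sends these expectations to `exp ∫ (g
- 1) dΛ`, and polar coordinates in the plane give the stated exponent.

The generating functional is computed for simple functions from independent Poisson counts, then
extended by `L¹(Λ)` approximation. Campbell's formula makes the error uniform in the number of
factors, so the two limits may be interchanged.

Convergence rests on `α > 2`: then `(1 + ‖x‖ ^ α)⁻¹` is integrable on the plane, and Campbell's
formula yields an almost surely summable series that dominates the received power at every time in
`[0, T_E]`. -/

/-- Replace one factor at a time; the remaining factors lie in the unit disc and cannot enlarge the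
error. -/
theorem norm_prod_sub_prod_le {ι : Type*} (s : Finset ι) (f g : ι → ℂ)
    (hf : ∀ i, ‖f i‖ ≤ 1) (hg : ∀ i, ‖g i‖ ≤ 1) :
    ‖∏ i ∈ s, f i - ∏ i ∈ s, g i‖ ≤ ∑ i ∈ s, ‖f i - g i‖ := by
  classical
  induction s using Finset.induction_on with
  | empty => simp
  | insert a s ha ih =>
    rw [Finset.prod_insert ha, Finset.prod_insert ha, Finset.sum_insert ha]
    have h1 : ‖∏ i ∈ s, f i‖ ≤ 1 := by
      rw [norm_prod]; exact Finset.prod_le_one (fun _ _ => norm_nonneg _) fun i _ => hf i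
    calc ‖f a * ∏ i ∈ s, f i - g a * ∏ i ∈ s, g i‖
        = ‖(f a - g a) * ∏ i ∈ s, f i + g a * (∏ i ∈ s, f i - ∏ i ∈ s, g i)‖ := by ring_nf
      _ ≤ ‖f a - g a‖ * ‖∏ i ∈ s, f i‖ + ‖g a‖ * ‖∏ i ∈ s, f i - ∏ i ∈ s, g i‖ := by
        simpa only [norm_mul] using norm_add_le ((f a - g a) * ∏ i ∈ s, f i)
          (g a * (∏ i ∈ s, f i - ∏ i ∈ s, g i))
      _ ≤ ‖f a - g a‖ * 1 + 1 * ∑ i ∈ s, ‖f i - g i‖ := by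
        gcongr
        exact hg a
      _ = _ := by ring

/-! ### Generating function and mean of the Poisson law -/

theorem integral_pow_poissonMeasure (r : NNReal) (c : ℂ) :
    ∫ n, c ^ n ∂(poissonMeasure r) = Complex.exp (r * (c - 1)) := by
  rw [integral_poissonMeasure]
  have h := (NormedSpace.expSeries_div_hasSum_exp ((r : ℂ) * c)).mul_left (Complex.exp (-r))
  rw [← Complex.exp_eq_exp_ℂ, ← Complex.exp_add] at h
  convert h.tsum_eq using 1
  · refine tsum_congr fun n => ?_
    rw [Complex.real_smul]
    push_cast
    rw [mul_pow]
    ring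
  · ring_nf

theorem lintegral_natCast_poissonMeasure (r : NNReal) :
    ∫⁻ n, (n : ENNReal) ∂(poissonMeasure r) = r := by
  have hnn : ∀ n : ℕ, 0 ≤ Real.exp (-r) * (r : ℝ) ^ n / (n.factorial : ℝ) := fun n => by positivity
  rw [poissonMeasure, lintegral_sum_measure]
  simp only [lintegral_smul_measure, lintegral_dirac, smul_eq_mul]
  -- The term at `0` vanishes; after the shift, the factor `n + 1` cancels against the factorial.
  rw [tsum_eq_zero_add' ENNReal.summable]
  simp only [Nat.cast_zero, mul_zero, zero_add]
  have h : ∀ n : ℕ, ENNReal.ofReal (Real.exp (-r) * (r : ℝ) ^ (n + 1) / ((n + 1).factorial : ℝ)) *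
      ((n + 1 : ℕ) : ENNReal) =
      ENNReal.ofReal (Real.exp (-r) * (r : ℝ) ^ n / (n.factorial : ℝ)) * r := fun n => by
    rw [← ENNReal.ofReal_natCast, ← ENNReal.ofReal_coe_nnreal (p := r),
      ← ENNReal.ofReal_mul (hnn _), ← ENNReal.ofReal_mul (hnn _)]
    congr 1
    rw [Nat.factorial_succ]
    push_cast
    field_simp
    ring
  simp only [h]
  rw [ENNReal.tsum_mul_right, ← ENNReal.ofReal_tsum_of_nonneg hnn
    (hasSum_one_poissonMeasure r).summable, (hasSum_one_poissonMeasure r).tsum_eq]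
  simp

/-! ### Poisson processes: counts, Campbell's formula, generating functional -/

theorem measurable_pointCount {Ω S : Type*} [MeasurableSpace Ω] [MeasurableSpace S]
    {X : ℕ → Ω → S} (hX : ∀ i, Measurable (X i)) {B : Set S} (hB : MeasurableSet B) :
    Measurable fun ω => pointCount (fun i => X i ω) B := by
  refine measurable_encard.comp (measurable_set_iff.2 fun i => ?_)
  exact measurableSet_setOfPred.1 (hX i hB)

theorem coe_pointCount {S : Type*} (X : ℕ → S) (B : Set S) :
    (pointCount X B : ENNReal) = ∑' i, B.indicator 1 (X i) := by
  rw [pointCount, ← ENNReal.tsum_set_one, tsum_subtype {i | X i ∈ B} (fun _ => (1 : ENNReal))]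
  rfl

namespace IsPoissonProcess

variable {Ω : Type*} [MeasurableSpace Ω] {S : Type*} [MeasurableSpace S]
  {X : ℕ → Ω → S} {Λ : Measure S} {P : Measure Ω}

/-- The Poisson weights of the finite values already sum to one, leaving no mass for `⊤`. -/
theorem ae_pointCount_ne_top [IsProbabilityMeasure P] (hX : IsPoissonProcess X Λ P) {B : Set S}
    (hB : MeasurableSet B) (hΛB : Λ B ≠ ⊤) :
    ∀ᵐ ω ∂P, pointCount (fun i => X i ω) B ≠ ⊤ := by
  have hm := measurable_pointCount hX.measurable hB
  have hk : ∀ k : ℕ, MeasurableSet {ω | pointCount (fun i => X i ω) B = (k : ℕ∞)} :=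
    fun k => hm (measurableSet_singleton _)
  have h1 : P (⋃ k : ℕ, {ω | pointCount (fun i => X i ω) B = (k : ℕ∞)}) = 1 := by
    rw [measure_iUnion _ hk]
    · rw [tsum_congr (hX.count_law B hB hΛB),
        ← measure_iUnion (fun i j hij => Set.disjoint_singleton.2 hij)
          (fun _ => measurableSet_singleton _)]
      simp [Set.iUnion_of_singleton]
    · intro i j hij
      refine Set.disjoint_left.2 fun ω hi hj => hij ?_
      exact_mod_cast (show ((i : ℕ) : ℕ∞) = j from hi.symm.trans hj)
  have h2 := (prob_compl_eq_zero_iff (MeasurableSet.iUnion hk)).2 h1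
  filter_upwards [compl_mem_ae_iff.2 h2] with ω hω htop
  simp [htop] at hω

theorem hasLaw_toNat_pointCount [IsProbabilityMeasure P] (hX : IsPoissonProcess X Λ P) {B : Set S}
    (hB : MeasurableSet B) (hΛB : Λ B ≠ ⊤) :
    HasLaw (fun ω => (pointCount (fun i => X i ω) B).toNat) (poissonMeasure (Λ B).toNNReal) P := by
  have hm : Measurable fun ω => (pointCount (fun i => X i ω) B).toNat :=
    Measurable.of_discrete.comp (measurable_pointCount hX.measurable hB)
  refine ⟨hm.aemeasurable, Measure.ext_of_singleton fun k => ?_⟩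
  rw [Measure.map_apply hm (measurableSet_singleton _), ← hX.count_law B hB hΛB]
  refine measure_congr ?_
  filter_upwards [hX.ae_pointCount_ne_top hB hΛB] with ω hω
  obtain ⟨m, hm⟩ := ENat.ne_top_iff_exists.1 hω
  simp only [eq_iff_iff]
  change (pointCount (fun i => X i ω) B).toNat = k ↔ pointCount (fun i => X i ω) B = k
  rw [← hm]
  simp

theorem integral_pow_pointCount [IsProbabilityMeasure P] (hX : IsPoissonProcess X Λ P) {B : Set S}
    (hB : MeasurableSet B) (hΛB : Λ B ≠ ⊤) (c : ℂ) :
    ∫ ω, c ^ (pointCount (fun i => X i ω) B).toNat ∂P = Complex.exp (Λ.real B * (c - 1)) := by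
  have h := (hX.hasLaw_toNat_pointCount hB hΛB).integral_comp (f := fun n => c ^ n)
    (by fun_prop)
  simp only [Function.comp_def] at h
  rw [h, integral_pow_poissonMeasure]
  rfl

theorem tsum_measure_preimage [IsProbabilityMeasure P] (hX : IsPoissonProcess X Λ P) {B : Set S}
    (hB : MeasurableSet B) (hΛB : Λ B ≠ ⊤) : ∑' i, P (X i ⁻¹' B) = Λ B := by
  have h1 : ∑' i, P (X i ⁻¹' B) = ∫⁻ ω, (pointCount (fun i => X i ω) B : ENNReal) ∂P := by
    simp only [coe_pointCount]
    rw [lintegral_tsum (f := fun i ω => B.indicator (1 : S → ENNReal) (X i ω)) fun i =>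
      ((measurable_one.indicator hB).comp (hX.measurable i)).aemeasurable]
    refine tsum_congr fun i => ?_
    rw [← lintegral_indicator_one (hX.measurable i hB)]
    rfl
  have h2 : ∫⁻ ω, (pointCount (fun i => X i ω) B : ENNReal) ∂P =
      ∫⁻ ω, ((pointCount (fun i => X i ω) B).toNat : ENNReal) ∂P := by
    refine lintegral_congr_ae ?_
    filter_upwards [hX.ae_pointCount_ne_top hB hΛB] with ω hω
    obtain ⟨m, hm⟩ := ENat.ne_top_iff_exists.1 hω
    simp [← hm]
  rw [h1, h2, (hX.hasLaw_toNat_pointCount hB hΛB).lintegral_comp (f := fun n => (n : ENNReal))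
    (by fun_prop), lintegral_natCast_poissonMeasure, ENNReal.coe_toNNReal hΛB]

/-- Both measures agree on sets of finite intensity, by taking the mean of the count; σ-finiteness
exhausts any set by such sets. -/
theorem sum_map [IsProbabilityMeasure P] [SigmaFinite Λ] (hX : IsPoissonProcess X Λ P) :
    Measure.sum (fun i => P.map (X i)) = Λ := by
  have key : ∀ B, MeasurableSet B → Λ B ≠ ⊤ → Measure.sum (fun i => P.map (X i)) B = Λ B := by
    intro B hB hΛB
    rw [Measure.sum_apply _ hB, ← hX.tsum_measure_preimage hB hΛB]
    exact tsum_congr fun i => Measure.map_apply (hX.measurable i) hB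
  ext B hB
  have hU : B = ⋃ n, B ∩ spanningSets Λ n := by
    rw [← inter_iUnion, iUnion_spanningSets, inter_univ]
  have hmono : Monotone fun n => B ∩ spanningSets Λ n := fun m n h =>
    inter_subset_inter_right _ (monotone_spanningSets Λ h)
  rw [hU, hmono.measure_iUnion, hmono.measure_iUnion]
  congr 1
  ext n
  exact key _ (hB.inter (measurableSet_spanningSets Λ n))
    (measure_ne_top_of_subset inter_subset_right (measure_spanningSets_lt_top Λ n).ne)

/-- Campbell's formula. -/
theorem tsum_lintegral [IsProbabilityMeasure P] [SigmaFinite Λ] (hX : IsPoissonProcess X Λ P)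
    {f : S → ENNReal} (hf : Measurable f) : ∑' i, ∫⁻ ω, f (X i ω) ∂P = ∫⁻ x, f x ∂Λ := by
  conv_rhs => rw [← hX.sum_map, lintegral_sum_measure]
  exact tsum_congr fun i => (lintegral_map hf (hX.measurable i)).symm

theorem integrable_prod [IsProbabilityMeasure P] (hX : IsPoissonProcess X Λ P) {g : S → ℂ}
    (hg : Measurable g) (hg1 : ∀ x, ‖g x‖ ≤ 1) (n : ℕ) :
    Integrable (fun ω => ∏ i ∈ Finset.range n, g (X i ω)) P := by
  refine Integrable.of_bound (C := 1) ?_ (Eventually.of_forall fun ω => ?_)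
  · exact (Finset.measurable_fun_prod _ fun i _ =>
      hg.comp (hX.measurable i)).aestronglyMeasurable
  · rw [norm_prod]
    exact Finset.prod_le_one (fun _ _ => norm_nonneg _) fun i _ => hg1 _

/-- The bound is free of `n`: the telescoped error is a partial sum of the series evaluated by
Campbell's formula. -/
theorem enorm_integral_prod_sub_le [IsProbabilityMeasure P] [SigmaFinite Λ]
    (hX : IsPoissonProcess X Λ P) {f g : S → ℂ} (hf : Measurable f) (hg : Measurable g)
    (hf1 : ∀ x, ‖f x‖ ≤ 1) (hg1 : ∀ x, ‖g x‖ ≤ 1) (n : ℕ) :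
    ‖∫ ω, ∏ i ∈ Finset.range n, f (X i ω) ∂P - ∫ ω, ∏ i ∈ Finset.range n, g (X i ω) ∂P‖ₑ ≤
      ∫⁻ x, ‖f x - g x‖ₑ ∂Λ := by
  rw [← integral_sub (hX.integrable_prod hf hf1 n) (hX.integrable_prod hg hg1 n)]
  refine (enorm_integral_le_lintegral_enorm _).trans ?_
  rw [← hX.tsum_lintegral (f := fun x => ‖f x - g x‖ₑ) (by fun_prop)]
  refine le_trans ?_ (ENNReal.sum_le_tsum (Finset.range n))
  rw [← lintegral_finsetSum _ fun i _ => by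
    have := hX.measurable i
    fun_prop]
  refine lintegral_mono fun ω => ?_
  have := norm_prod_sub_prod_le (Finset.range n) (fun i => f (X i ω)) (fun i => g (X i ω))
    (fun _ => hf1 _) (fun _ => hg1 _)
  rw [← ofReal_norm]
  refine (ENNReal.ofReal_le_ofReal this).trans ?_
  rw [ENNReal.ofReal_sum_of_nonneg fun _ _ => norm_nonneg _]
  simp only [ofReal_norm, le_refl]

theorem tendsto_integral_prod_simpleFunc [IsProbabilityMeasure P] (hX : IsPoissonProcess X Λ P)
    (g : SimpleFunc S ℂ) (hg1 : ∀ x, ‖g x‖ ≤ 1) (hfin : ∀ c ≠ 1, Λ (g ⁻¹' {c}) ≠ ⊤) :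
    Tendsto (fun n => ∫ ω, ∏ i ∈ Finset.range n, g (X i ω) ∂P) atTop
      (𝓝 (Complex.exp (∫ x, (g x - 1) ∂Λ))) := by
  classical
  -- The value `1` does not affect the product, and its fibre is the only one whose intensity may be
  -- infinite.
  set V := g.range.erase 1 with hV
  have hVne : ∀ c ∈ V, c ≠ 1 := fun c hc => Finset.ne_of_mem_erase hc
  have hBm : ∀ c : ℂ, MeasurableSet (g ⁻¹' {c}) := fun c => g.measurableSet_fiber c
  let N : ℂ → Ω → ℕ := fun c ω => (pointCount (fun i => X i ω) (g ⁻¹' {c})).toNat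
  have hlim : ∀ᵐ ω ∂P, Tendsto (fun n => ∏ i ∈ Finset.range n, g (X i ω)) atTop
      (𝓝 (∏ c : V, (c : ℂ) ^ N c ω)) := by
    have hae : ∀ᵐ ω ∂P, ∀ c : V, pointCount (fun i => X i ω) (g ⁻¹' {(c : ℂ)}) ≠ ⊤ :=
      ae_all_iff.2 fun c => hX.ae_pointCount_ne_top (hBm c) (hfin c (hVne c c.2))
    filter_upwards [hae] with ω hω
    have hprod : ∀ n, ∏ i ∈ Finset.range n, g (X i ω) =
        ∏ c : V, (c : ℂ) ^ ((Finset.range n).filter fun i => g (X i ω) = c).card := by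
      intro n
      rw [← Finset.prod_fiberwise_of_maps_to (t := g.range) (g := fun i => g (X i ω))
        (fun i _ => g.mem_range_self _)]
      rw [Finset.prod_coe_sort V
        (fun c => c ^ ((Finset.range n).filter fun i => g (X i ω) = c).card)]
      rw [hV, Finset.prod_erase _ (by simp)]
      refine Finset.prod_congr rfl fun c _ => ?_
      rw [← Finset.prod_const]
      exact Finset.prod_congr rfl fun i hi => (Finset.mem_filter.1 hi).2
    simp only [hprod]
    refine tendsto_finsetProd _ fun c _ => ?_
    -- Only finitely many points fall in the fibre, so the truncated count is eventually the full
    -- count.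
    refine tendsto_const_nhds.congr' ?_
    have hf : {i | X i ω ∈ g ⁻¹' {(c : ℂ)}}.Finite := Set.encard_ne_top_iff.1 (hω c)
    obtain ⟨m, hm⟩ := hf.bddAbove
    filter_upwards [eventually_gt_atTop m] with n hn
    congr 1
    change (Set.encard {i | X i ω ∈ g ⁻¹' {(c : ℂ)}}).toNat = _
    rw [← Set.ncard_def, ← Set.ncard_coe_finset]
    congr 1
    ext i
    simp only [mem_preimage, mem_singleton_iff, mem_ofPred_eq, Finset.coe_filter, Finset.mem_range]
    exact ⟨fun h => ⟨(hm h).trans_lt hn, h⟩, fun h => h.2⟩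
  have hDCT := tendsto_integral_of_dominated_convergence (fun _ => (1 : ℝ))
    (fun n => (hX.integrable_prod g.measurable hg1 n).aestronglyMeasurable)
    (integrable_const 1) (fun n => Eventually.of_forall fun ω => by
      rw [norm_prod]
      exact Finset.prod_le_one (fun _ _ => norm_nonneg _) fun i _ => hg1 _) hlim
  convert hDCT using 2
  let e := Fintype.equivFin V
  have hind : iIndepFun (fun (c : V) ω => pointCount (fun i => X i ω) (g ⁻¹' {(c : ℂ)})) P := by
    have h := hX.count_indep (Fintype.card V) (fun j => g ⁻¹' {((e.symm j : V) : ℂ)})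
      (fun j => hBm _) (fun j => hfin _ (hVne _ (e.symm j).2)) (fun j k hjk => by
        refine Set.disjoint_left.2 fun x hx hx' => hjk ?_
        exact e.symm.injective (Subtype.ext (hx.symm.trans hx')))
    have h' := h.precomp e.injective
    simpa using h'
  have hind' : iIndepFun (fun (c : V) ω => (c : ℂ) ^ N c ω) P :=
    hind.comp (fun (c : V) (k : ℕ∞) => (c : ℂ) ^ k.toNat) fun c => Measurable.of_discrete
  rw [hind'.integral_fun_prod_eq_prod_integral fun c =>
    ((Measurable.of_discrete (f := fun k : ℕ∞ => (c : ℂ) ^ k.toNat)).comp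
      (measurable_pointCount hX.measurable (hBm c))).aestronglyMeasurable]
  have hE : ∀ c : V, ∫ ω, (c : ℂ) ^ N c ω ∂P =
      Complex.exp (Λ.real (g ⁻¹' {(c : ℂ)}) * ((c : ℂ) - 1)) := fun c =>
    hX.integral_pow_pointCount (hBm c) (hfin c (hVne c c.2)) c
  simp only [hE]
  rw [← Complex.exp_sum]
  congr 1
  have hdec : ∀ x, g x - 1 = ∑ c : V, (g ⁻¹' {(c : ℂ)}).indicator (fun _ => (c : ℂ) - 1) x := by
    intro x
    rw [Finset.sum_coe_sort V (fun c => (g ⁻¹' {c}).indicator (fun _ => c - 1) x)]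
    by_cases hx : g x = 1
    · rw [Finset.sum_eq_zero]
      · simp [hx]
      · intro c hc
        refine indicator_of_notMem (fun h => hVne c hc ?_) _
        exact (show g x = c from h).symm.trans hx
    · rw [Finset.sum_eq_single (g x)]
      · simp
      · intro c _ hc
        exact indicator_of_notMem (s := g ⁻¹' {c}) (fun h => hc (show g x = c from h).symm)
          (fun _ => c - 1)
      · intro h
        exact absurd (Finset.mem_erase.2 ⟨hx, g.mem_range_self x⟩) h
  simp only [hdec]
  rw [integral_finsetSum]
  · refine Finset.sum_congr rfl fun c _ => ?_
    rw [integral_indicator_const _ (hBm c), Complex.real_smul]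
  · intro c _
    exact (integrable_indicator_iff (hBm c)).2
      (integrableOn_const (hfin c (hVne c c.2)))

/-- The probability generating functional of a Poisson process. -/
theorem tendsto_integral_prod [IsProbabilityMeasure P] [SigmaFinite Λ]
    (hX : IsPoissonProcess X Λ P) {g : S → ℂ} (hg : Measurable g) (hg1 : ∀ x, ‖g x‖ ≤ 1)
    (hint : Integrable (fun x => g x - 1) Λ) :
    Tendsto (fun n => ∫ ω, ∏ i ∈ Finset.range n, g (X i ω) ∂P) atTop
      (𝓝 (Complex.exp (∫ x, (g x - 1) ∂Λ))) := by
  have h₀ : (1 : ℂ) ∈ Metric.closedBall (0 : ℂ) 1 := by simp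
  -- With base point `1`, the approximants satisfy `‖G k - 1‖ ≤ 2 ‖g - 1‖`, hence are integrable
  -- after subtracting `1`; the closed disc keeps their norms at most `1`.
  let G : ℕ → SimpleFunc S ℂ := SimpleFunc.approxOn g hg (Metric.closedBall 0 1) 1 h₀
  have hG1 : ∀ k x, ‖G k x‖ ≤ 1 := fun k x => by
    simpa using SimpleFunc.approxOn_mem hg h₀ k x
  have hGint : ∀ k, Integrable (fun x => G k x - 1) Λ := fun k => by
    refine (hint.norm.add hint.norm).mono'
      (((G k).measurable.sub_const 1).aestronglyMeasurable) (Eventually.of_forall fun x => ?_)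
    exact SimpleFunc.norm_approxOn_y₀_le hg h₀ x k
  have hfin : ∀ k, ∀ c ≠ 1, Λ (G k ⁻¹' {c}) ≠ ⊤ := fun k c hc => by
    have hpos : 0 < ‖c - 1‖ := norm_pos_iff.2 (sub_ne_zero.2 hc)
    refine measure_ne_top_of_subset ?_ ((hGint k).measure_norm_ge_lt_top hpos).ne
    intro x hx
    have hx' : G k x = c := hx
    simp [hx']
  have hL1 : Tendsto (fun k => ∫⁻ x, ‖G k x - g x‖ₑ ∂Λ) atTop (𝓝 0) :=
    SimpleFunc.tendsto_approxOn_L1_enorm hg h₀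
      (Eventually.of_forall fun x => subset_closure (by simpa using hg1 x)) hint.2
  have hexp : Tendsto (fun k => Complex.exp (∫ x, (G k x - 1) ∂Λ)) atTop
      (𝓝 (Complex.exp (∫ x, (g x - 1) ∂Λ))) := by
    refine (Complex.continuous_exp.tendsto _).comp ?_
    refine tendsto_integral_of_L1 _ hint.aestronglyMeasurable (Eventually.of_forall hGint) ?_
    simpa using hL1
  -- Uniformity in `n` is what permits exchanging the limits in `k` and `n`.
  have hunif : TendstoUniformlyOnFilter
      (fun k n => ∫ ω, ∏ i ∈ Finset.range n, G k (X i ω) ∂P)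
      (fun n => ∫ ω, ∏ i ∈ Finset.range n, g (X i ω) ∂P) atTop atTop := by
    rw [uniformity_basis_edist.tendstoUniformlyOnFilter_iff_of_uniformity]
    intro ε hε
    rw [eventually_prod_iff]
    refine ⟨_, hL1.eventually (gt_mem_nhds hε), fun _ => True, by simp, fun {k} hk n _ => ?_⟩
    change edist _ _ < ε
    rw [edist_comm, edist_eq_enorm_sub]
    exact (hX.enorm_integral_prod_sub_le (G k).measurable hg (hG1 k) hg1 n).trans_lt hk
  exact hunif.tendsto_of_eventually_tendsto
    (Eventually.of_forall fun k => hX.tendsto_integral_prod_simpleFunc (G k) (hG1 k) (hfin k)) hexp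

end IsPoissonProcess

/-! ### Path-loss integrability and the exponential law -/

theorem integrable_inv_one_add_norm_rpow {E : Type*} [NormedAddCommGroup E] [NormedSpace ℝ E]
    [FiniteDimensional ℝ E] [MeasurableSpace E] [BorelSpace E] (μ : Measure E)
    [μ.IsAddHaarMeasure] {α : ℝ} (hα : (Module.finrank ℝ E : ℝ) < α) :
    Integrable (fun x : E => (1 + ‖x‖ ^ α)⁻¹) μ := by
  have hα0 : 0 < α := (Nat.cast_nonneg _).trans_lt hα
  -- The constant `2 ^ α` comes from `(1 + r) / 2 ≤ max 1 r`, whence `((1 + r) / 2) ^ α ≤ 1 + r ^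
  -- α`.
  refine ((integrable_one_add_norm (μ := μ) hα).const_mul (2 ^ α)).mono' ?_
    (Eventually.of_forall fun x => ?_)
  · exact (Measurable.inv (by fun_prop)).aestronglyMeasurable
  · have h0 : 0 ≤ ‖x‖ := norm_nonneg x
    have hp : 0 ≤ ‖x‖ ^ α := Real.rpow_nonneg h0 _
    rw [Real.norm_of_nonneg (by positivity), Real.rpow_neg (by positivity), ← div_eq_mul_inv,
      inv_le_comm₀ (by positivity) (by positivity), inv_div,
      ← Real.div_rpow (by positivity) (by positivity)]
    rcases le_total ‖x‖ 1 with h | h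
    · calc ((1 + ‖x‖) / 2) ^ α ≤ 1 := Real.rpow_le_one (by positivity) (by linarith) hα0.le
        _ ≤ _ := by linarith
    · calc ((1 + ‖x‖) / 2) ^ α ≤ ‖x‖ ^ α :=
            Real.rpow_le_rpow (by positivity) (by linarith) hα0.le
        _ ≤ _ := by linarith

theorem integral_expMeasure_one {E : Type*} [NormedAddCommGroup E] [NormedSpace ℝ E] (f : ℝ → E) :
    ∫ x, f x ∂(expMeasure 1) = ∫ x in Ioi 0, Real.exp (-x) • f x := by
  rw [expMeasure, gammaMeasure, integral_withDensity_eq_integral_toReal_smul]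
  · rw [← integral_Ici_eq_integral_Ioi, ← integral_indicator measurableSet_Ici]
    refine integral_congr_ae (Eventually.of_forall fun x => ?_)
    have h := exponentialPDF_eq 1 x
    rw [exponentialPDF, exponentialPDFReal] at h
    by_cases hx : 0 ≤ x
    · simp [gammaPDF, h, hx, ENNReal.toReal_ofReal (Real.exp_nonneg _)]
    · simp [gammaPDF, h, hx]
  · exact (measurable_gammaPDFReal 1 1).ennreal_ofReal
  · exact Eventually.of_forall fun x => ENNReal.ofReal_lt_top

theorem integral_cexp_expMeasure_one (c : ℝ) :
    ∫ x, Complex.exp (Complex.I * (c * x : ℝ)) ∂(expMeasure 1) = 1 / (1 - Complex.I * c) := by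
  rw [integral_expMeasure_one]
  have h : ∀ x : ℝ, Real.exp (-x) • Complex.exp (Complex.I * (c * x : ℝ)) =
      Complex.exp ((Complex.I * c - 1) * x) := fun x => by
    rw [Complex.real_smul, Complex.ofReal_exp, ← Complex.exp_add]
    push_cast
    ring_nf
  simp only [h]
  rw [integral_exp_mul_complex_Ioi (by simp)]
  rw [← neg_sub (Complex.I * (c : ℂ)) 1, one_div, inv_neg]
  simp [div_eq_mul_inv]

theorem lintegral_enorm_expMeasure_one_ne_top : ∫⁻ x, ‖x‖ₑ ∂(expMeasure 1) ≠ ⊤ := by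
  -- The first moment is the integral defining `Γ(2)`.
  have hG := Real.GammaIntegral_convergent (s := 2) (by norm_num)
  rw [expMeasure, gammaMeasure]
  unfold gammaPDF
  rw [lintegral_withDensity_eq_lintegral_mul _ (measurable_gammaPDFReal 1 1).ennreal_ofReal
      measurable_enorm]
  refine ne_top_of_le_ne_top hG.2.ne ?_
  rw [← lintegral_indicator measurableSet_Ioi]
  refine lintegral_mono fun x => ?_
  have h := exponentialPDF_eq 1 x
  rw [exponentialPDF, exponentialPDFReal] at h
  rcases lt_trichotomy x 0 with hx | rfl | hx
  · simp [h, hx.not_ge]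
  · simp
  · have h2 : (2 : ℝ) - 1 = 1 := by norm_num
    simp only [Pi.mul_apply, h, hx.le, if_true, one_mul, indicator_of_mem (mem_Ioi.2 hx),
      h2, Real.rpow_one, enorm_mul]
    rw [Real.enorm_of_nonneg (Real.exp_nonneg _)]

/-! ### The overlap length and the algebra of the integrand -/

/-- A single formula for the three regimes, from which continuity, sign and support can be read off.
-/
theorem psi_eq {T_I T_E : ℝ} (hT_I : 0 < T_I) (hT_E : 0 < T_E) (t : ℝ) :
    psi T_I T_E t = max 0 (min (t + T_I) T_E - max t 0) := by
  unfold psi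
  rcases le_total (t + T_I) T_E with h1 | h1 <;> rcases le_total t 0 with h2 | h2 <;>
    simp only [h1, h2, min_eq_left, min_eq_right, max_eq_left, max_eq_right] <;>
    split_ifs <;>
    first
      | (rw [max_eq_right (by grind)] <;> grind)
      | (rw [max_eq_left (by grind)])

theorem psi_nonneg {T_I T_E : ℝ} (hT_I : 0 < T_I) (hT_E : 0 < T_E) (t : ℝ) :
    0 ≤ psi T_I T_E t := by
  rw [psi_eq hT_I hT_E]
  exact le_max_left _ _

theorem psi_le_indicator {T_I T_E : ℝ} (hT_I : 0 < T_I) (hT_E : 0 < T_E) (t : ℝ) :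
    psi T_I T_E t ≤ T_E * (Ioc (-T_I) T_E).indicator 1 t := by
  rw [psi_eq hT_I hT_E]
  by_cases ht : t ∈ Ioc (-T_I) T_E
  · rw [indicator_of_mem ht, Pi.one_apply]
    grind
  · rw [indicator_of_notMem ht]
    rw [mem_Ioc, not_and_or] at ht
    grind

theorem continuous_psi {T_I T_E : ℝ} (hT_I : 0 < T_I) (hT_E : 0 < T_E) :
    Continuous (psi T_I T_E) := by
  rw [funext (psi_eq hT_I hT_E)]
  fun_prop

theorem integral_activity {T_I T_E : ℝ} (hT_I : 0 < T_I) (hT_E : 0 < T_E) (t : ℝ) :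
    ∫ τ in (0 : ℝ)..T_E, activity T_I τ t = psi T_I T_E t := by
  unfold activity
  rw [intervalIntegral.integral_of_le hT_E.le, ← integral_Icc_eq_integral_Ioc,
    setIntegral_indicator measurableSet_Icc, Icc_inter_Icc, psi_eq hT_I hT_E]
  simp [Measure.real, ENNReal.toReal_ofReal', max_comm, min_comm]

theorem norm_one_sub_I_mul_ge (c : ℝ) : 1 ≤ ‖(1 : ℂ) - Complex.I * c‖ := by
  refine le_trans ?_ (Complex.abs_re_le_norm _)
  simp

theorem norm_inv_one_sub_I_mul_le (c : ℝ) : ‖1 / ((1 : ℂ) - Complex.I * c)‖ ≤ 1 := by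
  rw [norm_div, norm_one]
  exact div_le_one_of_le₀ (norm_one_sub_I_mul_ge c) (norm_nonneg _)

/-- With `c = z P₁ ψ(t)` and `a = 1 + ‖x‖ ^ α` this identifies `g - 1` with the integrand of the
exponent. -/
theorem inv_one_sub_I_mul_sub_one (c a : ℝ) (ha : 0 < a) :
    1 / ((1 : ℂ) - Complex.I * (c * a⁻¹ : ℝ)) - 1 =
      Complex.I * (c : ℝ) / ((a : ℂ) - Complex.I * c) := by
  have h1 : (a : ℂ) ≠ 0 := by exact_mod_cast ha.ne'
  have h2 : (a : ℂ) - Complex.I * c ≠ 0 := fun h => by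
    have := congrArg Complex.re h
    simp at this
    exact ha.ne' this
  have h3 : (1 : ℂ) - Complex.I * (c * a⁻¹ : ℝ) = ((a : ℂ) - Complex.I * c) / a := by
    push_cast
    field_simp
  rw [h3]
  field_simp
  ring

theorem norm_I_mul_div_le (c a : ℝ) (ha : 0 < a) :
    ‖Complex.I * (c : ℝ) / ((a : ℂ) - Complex.I * c)‖ ≤ |c| * a⁻¹ := by
  rw [norm_div, norm_mul, Complex.norm_I, one_mul, Complex.norm_real, Real.norm_eq_abs,
    div_eq_mul_inv]
  gcongr
  refine le_trans ?_ (Complex.abs_re_le_norm _)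
  simp [le_abs_self]

/-! ### Sums over the points with independent marks -/

/-- The probability generating functional of a Poisson process determines the characteristic
functions of the sums over its points of independent exponential marks. -/
theorem integral_cexp_sum_mul_eq {Ω S : Type*} [MeasurableSpace Ω] [MeasurableSpace S]
    {P : Measure Ω} [IsProbabilityMeasure P] {X : ℕ → Ω → S} (hX : ∀ i, Measurable (X i))
    {h : ℕ → Ω → ℝ} (hh_meas : ∀ i, Measurable (h i))
    (hh_law : ∀ i, HasLaw (h i) (expMeasure 1) P) (hh_indep : iIndepFun h P)
    (hXh : IndepFun (fun ω i => X i ω) (fun ω i => h i ω) P) {w : S → ℝ} (hw : Measurable w)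
    (n : ℕ) :
    ∫ ω, Complex.exp (Complex.I * (∑ i ∈ Finset.range n, w (X i ω) * h i ω : ℝ)) ∂P =
      ∫ ω, ∏ i ∈ Finset.range n, 1 / (1 - Complex.I * (w (X i ω) : ℂ)) ∂P := by
  have hXm : Measurable fun ω i => X i ω := measurable_pi_lambda _ hX
  have hhm : Measurable fun ω i => h i ω := measurable_pi_lambda _ hh_meas
  have hprob := Measure.isProbabilityMeasure_map (μ := P) hXm.aemeasurable
  have hprob' := Measure.isProbabilityMeasure_map (μ := P) hhm.aemeasurable
  let F : (ℕ → S) × (ℕ → ℝ) → ℂ := fun q =>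
    Complex.exp (Complex.I * (∑ i ∈ Finset.range n, w (q.1 i) * q.2 i : ℝ))
  have hF : Measurable F := by
    have hs : Measurable fun q : (ℕ → S) × (ℕ → ℝ) =>
        ∑ i ∈ Finset.range n, w (q.1 i) * q.2 i :=
      Finset.measurable_fun_sum _ fun i _ =>
        (hw.comp ((measurable_pi_apply i).comp measurable_fst)).mul
          ((measurable_pi_apply i).comp measurable_snd)
    fun_prop
  have hFint : Integrable F (((P.map fun ω i => X i ω)).prod (P.map fun ω i => h i ω)) := by
    refine Integrable.of_bound hF.aestronglyMeasurable 1 (Eventually.of_forall fun q => ?_)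
    simp only [F]
    rw [mul_comm, Complex.norm_exp_ofReal_mul_I]
  -- With the positions frozen, independence of the marks factorises the expectation into
  -- exponential characteristic functions; Fubini then restores the positions.
  have hinner : ∀ x : ℕ → S, ∫ y, F (x, y) ∂(P.map fun ω i => h i ω) =
      ∏ i ∈ Finset.range n, 1 / (1 - Complex.I * (w (x i) : ℂ)) := by
    intro x
    rw [integral_map hhm.aemeasurable (f := fun y => F (x, y))
      (hF.comp measurable_prodMk_left).aestronglyMeasurable]
    have hprod : ∀ ω, F (x, fun i => h i ω) =
        ∏ j : Fin n, Complex.exp (Complex.I * (w (x j) * h j ω : ℝ)) := by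
      intro ω
      simp only [F]
      rw [← Complex.exp_sum, Finset.sum_range, Complex.ofReal_sum, Finset.mul_sum]
    have hind : iIndepFun (fun (j : Fin n) ω => Complex.exp (Complex.I * (w (x j) * h j ω : ℝ)))
        P :=
      (hh_indep.precomp (g := fun j : Fin n => (j : ℕ)) Fin.val_injective).comp
        (fun (j : Fin n) r => Complex.exp (Complex.I * (w (x j) * r : ℝ))) fun j => by fun_prop
    simp only [hprod]
    rw [hind.integral_fun_prod_eq_prod_integral fun j => by
      have := hh_meas j
      exact Measurable.aestronglyMeasurable (by fun_prop), Finset.prod_range]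
    refine Finset.prod_congr rfl fun j _ => ?_
    rw [← integral_cexp_expMeasure_one]
    exact (hh_law j).integral_comp (f := fun r : ℝ => Complex.exp (Complex.I * (w (x j) * r : ℝ)))
      (Measurable.aestronglyMeasurable (by fun_prop))
  calc ∫ ω, F (fun i => X i ω, fun i => h i ω) ∂P
      = ∫ q, F q ∂((P.map fun ω i => X i ω).prod (P.map fun ω i => h i ω)) := by
        rw [← (indepFun_iff_map_prod_eq_prod_map_map hXm.aemeasurable hhm.aemeasurable).1 hXh,
          integral_map (hXm.prodMk hhm).aemeasurable hF.aestronglyMeasurable]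
    _ = ∫ x, ∏ i ∈ Finset.range n, 1 / (1 - Complex.I * (w (x i) : ℂ))
          ∂(P.map fun ω i => X i ω) := by
        rw [integral_prod _ hFint]
        simp only [hinner]
    _ = _ := by
        rw [integral_map hXm.aemeasurable]
        refine (Finset.measurable_fun_prod _ fun i _ => ?_).aestronglyMeasurable
        have : Measurable fun x : ℕ → S => w (x i) := hw.comp (measurable_pi_apply i)
        fun_prop

/-- The expected sum is `∫ f dΛ` times the mean of `|h|`, by independence and Campbell's formula,
hence finite. -/
theorem IsPoissonProcess.ae_summable_mul_abs {Ω S : Type*} [MeasurableSpace Ω] [MeasurableSpace S]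
    {P : Measure Ω} [IsProbabilityMeasure P] {Λ : Measure S} [SigmaFinite Λ] {X : ℕ → Ω → S}
    (hX : IsPoissonProcess X Λ P) {h : ℕ → Ω → ℝ} (hh_meas : ∀ i, Measurable (h i))
    (hh_law : ∀ i, HasLaw (h i) (expMeasure 1) P)
    (hXh : IndepFun (fun ω i => X i ω) (fun ω i => h i ω) P) {f : S → ℝ} (hf : Measurable f)
    (hfi : Integrable f Λ) (hf0 : ∀ x, 0 ≤ f x) :
    ∀ᵐ ω ∂P, Summable fun i => f (X i ω) * |h i ω| := by
  have hXm := hX.measurable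
  have hlin : ∫⁻ ω, ∑' i, ‖f (X i ω)‖ₑ * ‖h i ω‖ₑ ∂P ≠ ⊤ := by
    rw [lintegral_tsum fun i => by
      have := hXm i
      have := hh_meas i
      fun_prop]
    have hterm : ∀ i, ∫⁻ ω, ‖f (X i ω)‖ₑ * ‖h i ω‖ₑ ∂P =
        (∫⁻ ω, ‖f (X i ω)‖ₑ ∂P) * ∫⁻ x, ‖x‖ₑ ∂(expMeasure 1) := by
      intro i
      have hind : IndepFun (fun ω => ‖f (X i ω)‖ₑ) (fun ω => ‖h i ω‖ₑ) P :=
        hXh.comp (φ := fun x : ℕ → S => ‖f (x i)‖ₑ) (ψ := fun y : ℕ → ℝ => ‖y i‖ₑ)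
          (hf.comp (measurable_pi_apply i)).enorm (measurable_pi_apply i).enorm
      have := lintegral_mul_eq_lintegral_mul_lintegral_of_indepFun
        (hf.comp (hXm i)).enorm (hh_meas i).enorm hind
      rw [← (hh_law i).lintegral_comp (f := fun x => ‖x‖ₑ) (by fun_prop)]
      exact this
    simp only [hterm]
    rw [ENNReal.tsum_mul_right, hX.tsum_lintegral (f := fun x => ‖f x‖ₑ) (by fun_prop)]
    exact ENNReal.mul_ne_top hfi.2.ne lintegral_enorm_expMeasure_one_ne_top
  have hmeas : Measurable fun ω => ∑' i, ‖f (X i ω)‖ₑ * ‖h i ω‖ₑ :=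
    Measurable.tsum fun i => by
      have := hXm i
      have := hh_meas i
      fun_prop
  filter_upwards [ae_lt_top hmeas hlin] with ω hω
  have hs := ENNReal.summable_toReal hω.ne
  convert hs using 2 with i
  rw [ENNReal.toReal_mul, toReal_enorm, toReal_enorm, Real.norm_of_nonneg (hf0 _),
    Real.norm_eq_abs]

/-! ### The harvested energy of a fixed configuration -/

theorem measurable_receivedGain (α T_I : ℝ) (p : SpaceTime) (h : ℝ) :
    Measurable (receivedGain α T_I p h) := by
  unfold receivedGain activity
  exact ((measurable_const.indicator measurableSet_Icc).mul_const _).mul_const _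

/-- A transmission active at some time in `[0, T_E]` starts in `[-T_I, T_E]`. The bound does not
depend on `t`, so one summable series gives convergence at all times, integrability, and the
exchange of sum and integral. -/
theorem abs_receivedGain_le {α T_I T_E t : ℝ} (ht : t ∈ Icc 0 T_E) (p : SpaceTime) (h : ℝ) :
    |receivedGain α T_I p h t| ≤
      (Icc (-T_I) T_E).indicator 1 p.2 * (1 + ‖p.1‖ ^ α)⁻¹ * |h| := by
  have hA : 0 ≤ (1 + ‖p.1‖ ^ α)⁻¹ := by positivity
  unfold receivedGain activity
  by_cases hp : t ∈ Icc p.2 (p.2 + T_I)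
  · have hp' : p.2 ∈ Icc (-T_I) T_E :=
      ⟨by linarith [hp.2, ht.1], hp.1.trans ht.2⟩
    rw [indicator_of_mem hp, indicator_of_mem hp', abs_mul, abs_mul, abs_of_nonneg hA]
    simp [mul_comm]
  · rw [indicator_of_notMem hp]
    simp only [zero_mul, abs_zero]
    exact mul_nonneg (mul_nonneg (indicator_nonneg (fun _ _ => zero_le_one) _) hA) (abs_nonneg _)

theorem integral_receivedGain {α T_I T_E : ℝ} (hT_I : 0 < T_I) (hT_E : 0 < T_E) (p : SpaceTime)
    (h : ℝ) : ∫ t in (0 : ℝ)..T_E, receivedGain α T_I p h t =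
      psi T_I T_E p.2 * (1 + ‖p.1‖ ^ α)⁻¹ * h := by
  simp only [receivedGain, mul_assoc]
  rw [intervalIntegral.integral_mul_const, integral_activity hT_I hT_E]
  ring

section Deterministic

variable {P₁ α T_I T_E : ℝ} {X : ℕ → SpaceTime} {h : ℕ → ℝ}

theorem summable_receivedGain
    (hs : Summable fun i => (Icc (-T_I) T_E).indicator 1 (X i).2 * (1 + ‖(X i).1‖ ^ α)⁻¹ * |h i|)
    {t : ℝ} (ht : t ∈ Icc 0 T_E) : Summable fun i => receivedGain α T_I (X i) (h i) t :=
  Summable.of_norm_bounded hs fun _ => abs_receivedGain_le ht _ _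

theorem intervalIntegrable_incidentPower (hT_E : 0 < T_E)
    (hs : Summable fun i =>
      (Icc (-T_I) T_E).indicator 1 (X i).2 * (1 + ‖(X i).1‖ ^ α)⁻¹ * |h i|) :
    IntervalIntegrable (incidentPower P₁ α T_I X h) volume 0 T_E := by
  refine IntervalIntegrable.const_mul ?_ _
  rw [intervalIntegrable_iff_integrableOn_Icc_of_le hT_E.le]
  refine Integrable.of_bound (C := ∑' i, (Icc (-T_I) T_E).indicator 1 (X i).2 *
    (1 + ‖(X i).1‖ ^ α)⁻¹ * |h i|) ?_ ?_
  · refine aestronglyMeasurable_of_tendsto_ae atTop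
      (f := fun n t => ∑ i ∈ Finset.range n, receivedGain α T_I (X i) (h i) t) (fun n => ?_) ?_
    · exact (Finset.measurable_fun_sum _ fun i _ =>
        measurable_receivedGain α T_I (X i) (h i)).aestronglyMeasurable
    · filter_upwards [ae_restrict_mem measurableSet_Icc] with t ht
      exact (summable_receivedGain hs ht).hasSum.tendsto_sum_nat
  · filter_upwards [ae_restrict_mem measurableSet_Icc] with t ht
    exact tsum_of_norm_bounded hs.hasSum fun _ => abs_receivedGain_le ht _ _

theorem hasSum_harvestedEnergy (hT_I : 0 < T_I) (hT_E : 0 < T_E)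
    (hs : Summable fun i =>
      (Icc (-T_I) T_E).indicator 1 (X i).2 * (1 + ‖(X i).1‖ ^ α)⁻¹ * |h i|) :
    HasSum (fun i => P₁ * (psi T_I T_E (X i).2 * (1 + ‖(X i).1‖ ^ α)⁻¹) * h i)
      (harvestedEnergy P₁ α T_I T_E X h) := by
  have h01 : ∀ t, t ∈ uIoc 0 T_E → t ∈ Icc 0 T_E := fun t ht => by
    rw [uIoc_of_le hT_E.le] at ht
    exact Ioc_subset_Icc_self ht
  unfold harvestedEnergy incidentPower
  rw [intervalIntegral.integral_const_mul]
  simp only [mul_assoc P₁]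
  refine HasSum.mul_left P₁ ?_
  simp only [← integral_receivedGain hT_I hT_E]
  refine intervalIntegral.hasSum_integral_of_dominated_convergence
    (fun i _ => (Icc (-T_I) T_E).indicator 1 (X i).2 * (1 + ‖(X i).1‖ ^ α)⁻¹ * |h i|)
    (fun i => (measurable_receivedGain α T_I (X i) (h i)).aestronglyMeasurable)
    (fun i => Eventually.of_forall fun t ht => abs_receivedGain_le (h01 t ht) _ _)
    (Eventually.of_forall fun _ _ => hs) (by simp)
    (Eventually.of_forall fun t ht => (summable_receivedGain hs (h01 t ht)).hasSum)

end Deterministic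

/-! ### The exponent: integrability and polar coordinates -/

section Exponent

variable {P₁ α T_I T_E : ℝ}

theorem integrable_indicator_mul_inv_one_add_norm_rpow (hα : 2 < α) :
    Integrable (fun p : SpaceTime => (Icc (-T_I) T_E).indicator 1 p.2 * (1 + ‖p.1‖ ^ α)⁻¹)
      volume := by
  have h1 := integrable_inv_one_add_norm_rpow (volume : Measure (EuclideanSpace ℝ (Fin 2)))
    (α := α) (by simpa using hα)
  have h2 : Integrable ((Icc (-T_I) T_E).indicator (1 : ℝ → ℝ)) volume :=
    (integrable_indicator_iff measurableSet_Icc).2 (integrableOn_const (by simp))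
  refine (h1.mul_prod h2).congr (Eventually.of_forall fun p => ?_)
  exact mul_comm _ _

/-- The factor `u` is the Jacobian of polar coordinates in dimension two. -/
theorem charIntegrand_eq_smul (P₁ α T_I T_E z t u : ℝ) :
    charIntegrand P₁ α T_I T_E z t u =
      u • (Complex.I * (z * P₁ * psi T_I T_E t : ℝ) /
        (((1 + u ^ α : ℝ) : ℂ) - Complex.I * (z * P₁ * psi T_I T_E t : ℝ))) := by
  rw [charIntegrand, Complex.real_smul]
  push_cast
  ring

theorem integrable_exponent_norm (hα : 2 < α) (c : ℝ) :
    Integrable (fun x : EuclideanSpace ℝ (Fin 2) =>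
      Complex.I * (c : ℝ) / (((1 + ‖x‖ ^ α : ℝ) : ℂ) - Complex.I * c)) volume := by
  have h1 := integrable_inv_one_add_norm_rpow (volume : Measure (EuclideanSpace ℝ (Fin 2)))
    (α := α) (by simpa using hα)
  refine (h1.const_mul |c|).mono' ?_ (Eventually.of_forall fun x => ?_)
  · exact (Measurable.div (by fun_prop) (by fun_prop)).aestronglyMeasurable
  · exact norm_I_mul_div_le c _ (by positivity)

theorem integrableOn_charIntegrand (hα : 2 < α) (z t : ℝ) :
    IntegrableOn (charIntegrand P₁ α T_I T_E z t) (Ioi 0) := by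
  have h := (integrable_fun_norm_addHaar (volume : Measure (EuclideanSpace ℝ (Fin 2)))
    (f := fun r => Complex.I * (z * P₁ * psi T_I T_E t : ℝ) /
        (((1 + r ^ α : ℝ) : ℂ) - Complex.I * (z * P₁ * psi T_I T_E t : ℝ)))).1
      (integrable_exponent_norm hα _)
  refine h.congr_fun (fun u _ => ?_) measurableSet_Ioi
  simp [charIntegrand_eq_smul]

theorem integral_exponent_norm (z t : ℝ) :
    ∫ x : EuclideanSpace ℝ (Fin 2), Complex.I * (z * P₁ * psi T_I T_E t : ℝ) /
        (((1 + ‖x‖ ^ α : ℝ) : ℂ) - Complex.I * (z * P₁ * psi T_I T_E t : ℝ)) =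
      2 * (Real.pi : ℂ) * ∫ u in Ioi (0 : ℝ), charIntegrand P₁ α T_I T_E z t u := by
  rw [integral_fun_norm_addHaar (volume : Measure (EuclideanSpace ℝ (Fin 2)))
    (fun r => Complex.I * (z * P₁ * psi T_I T_E t : ℝ) /
        (((1 + r ^ α : ℝ) : ℂ) - Complex.I * (z * P₁ * psi T_I T_E t : ℝ)))]
  simp only [charIntegrand_eq_smul]
  -- In `2π`, the `2` is the dimension and `π` is the area of the unit disc.
  simp [Measure.real, ENNReal.toReal_ofReal Real.pi_pos.le, mul_assoc]

theorem integrable_exponent (hα : 2 < α) (hT_I : 0 < T_I) (hT_E : 0 < T_E) (z : ℝ) :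
    Integrable (fun p : SpaceTime => Complex.I * (z * P₁ * psi T_I T_E p.2 : ℝ) /
        (((1 + ‖p.1‖ ^ α : ℝ) : ℂ) - Complex.I * (z * P₁ * psi T_I T_E p.2 : ℝ))) volume := by
  have hpsi := (continuous_psi hT_I hT_E).measurable
  refine ((integrable_indicator_mul_inv_one_add_norm_rpow (T_I := T_I) (T_E := T_E) hα).const_mul
    (|z * P₁| * T_E)).mono' ?_ (Eventually.of_forall fun p => ?_)
  · exact (Measurable.div (by fun_prop) (by fun_prop)).aestronglyMeasurable
  · refine (norm_I_mul_div_le _ _ (by positivity)).trans ?_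
    rw [abs_mul, abs_of_nonneg (psi_nonneg hT_I hT_E _)]
    have h1 : psi T_I T_E p.2 ≤ T_E * (Icc (-T_I) T_E).indicator 1 p.2 :=
      (psi_le_indicator hT_I hT_E _).trans (mul_le_mul_of_nonneg_left
        (indicator_le_indicator_of_subset Ioc_subset_Icc_self (fun _ => zero_le_one) _) hT_E.le)
    calc |z * P₁| * psi T_I T_E p.2 * (1 + ‖p.1‖ ^ α)⁻¹
        ≤ |z * P₁| * (T_E * (Icc (-T_I) T_E).indicator 1 p.2) * (1 + ‖p.1‖ ^ α)⁻¹ := by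
          gcongr
      _ = _ := by ring

theorem integrable_integral_charIntegrand (hα : 2 < α) (hT_I : 0 < T_I) (hT_E : 0 < T_E) (z : ℝ) :
    Integrable (fun t => ∫ u in Ioi (0 : ℝ), charIntegrand P₁ α T_I T_E z t u) volume := by
  have h := (integrable_exponent (P₁ := P₁) hα hT_I hT_E z).integral_prod_right
  simp only [integral_exponent_norm] at h
  have hpi : 2 * (Real.pi : ℂ) ≠ 0 := by simp [Real.pi_ne_zero]
  simpa [← mul_assoc, hpi] using h.const_mul (2 * (Real.pi : ℂ))⁻¹

theorem integral_exponent (hα : 2 < α) (hT_I : 0 < T_I) (hT_E : 0 < T_E) (z : ℝ) :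
    ∫ p : SpaceTime, Complex.I * (z * P₁ * psi T_I T_E p.2 : ℝ) /
        (((1 + ‖p.1‖ ^ α : ℝ) : ℂ) - Complex.I * (z * P₁ * psi T_I T_E p.2 : ℝ)) =
      2 * (Real.pi : ℂ) *
        ∫ t in (-T_I)..T_E, ∫ u in Ioi (0 : ℝ), charIntegrand P₁ α T_I T_E z t u := by
  have h := integral_prod_symm _ (integrable_exponent (P₁ := P₁) hα hT_I hT_E z)
  rw [Measure.volume_eq_prod, h]
  simp only [integral_exponent_norm]
  rw [integral_const_mul, intervalIntegral.integral_of_le (by linarith),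
    setIntegral_eq_integral_of_forall_compl_eq_zero]
  -- Outside `(-T_I, T_E]` the overlap is zero, and so is the integrand; the integral over all
  -- starting times reduces to this interval.
  intro t ht
  have h0 : psi T_I T_E t = 0 := by
    refine le_antisymm ?_ (psi_nonneg hT_I hT_E t)
    simpa [indicator_of_notMem ht] using psi_le_indicator hT_I hT_E t
  simp [charIntegrand, h0]

end Exponent

/-! ### Assembly -/

theorem lemma1 {Ω : Type*} [MeasurableSpace Ω] (P : Measure Ω) [IsProbabilityMeasure P]
    (lam₁ P₁ α T_I T_E : ℝ) (hlam : 0 < lam₁) (hP₁ : 0 < P₁) (hα : 2 < α)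
    (hT_I : 0 < T_I) (hT_E : 0 < T_E)
    -- the transmitters: a homogeneous space-time Poisson process of density `lam₁`
    (X : ℕ → Ω → SpaceTime)
    (hX : IsPoissonProcess X (ENNReal.ofReal lam₁ • (volume : Measure SpaceTime)) P)
    -- the channel coefficients: i.i.d. `Exp(1)`, independent of the transmitters
    (h : ℕ → Ω → ℝ) (hh_meas : ∀ i, Measurable (h i))
    (hh_law : ∀ i, HasLaw (h i) (expMeasure 1) P) (hh_indep : iIndepFun h P)
    (hXh : IndepFun (fun ω i => X i ω) (fun ω i => h i ω) P) :
    -- the harvested energy is a well-defined random variable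
    (∀ᵐ ω ∂P,
      (∀ t ∈ Icc (0 : ℝ) T_E, Summable fun i => receivedGain α T_I (X i ω) (h i ω) t) ∧
      IntervalIntegrable (incidentPower P₁ α T_I (fun i => X i ω) (fun i => h i ω))
        volume 0 T_E) ∧
    AEMeasurable
      (fun ω => harvestedEnergy P₁ α T_I T_E (fun i => X i ω) (fun i => h i ω)) P ∧
    -- `ψ(t)` is the length of the overlap of `[t, t + T_I]` with `[0, T_E]`
    (∀ t : ℝ, ∫ τ in (0 : ℝ)..T_E, activity T_I τ t = psi T_I T_E t) ∧
    -- the characteristic function, including convergence of the integrals in it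
    ∀ z : ℝ,
      (∀ t : ℝ, IntegrableOn (charIntegrand P₁ α T_I T_E z t) (Ioi 0)) ∧
      IntervalIntegrable (fun t => ∫ u in Ioi (0 : ℝ), charIntegrand P₁ α T_I T_E z t u)
        volume (-T_I) T_E ∧
      charFun
          (P.map fun ω => harvestedEnergy P₁ α T_I T_E (fun i => X i ω) (fun i => h i ω)) z =
        Complex.exp (2 * (Real.pi : ℂ) * (lam₁ : ℂ) *
          ∫ t in (-T_I)..T_E, ∫ u in Ioi (0 : ℝ), charIntegrand P₁ α T_I T_E z t u) := by
  have hXm := hX.measurable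
  have hpsi := (continuous_psi hT_I hT_E).measurable
  have hσ : SigmaFinite (ENNReal.ofReal lam₁ • (volume : Measure SpaceTime)) :=
    SMul.sigmaFinite lam₁.toNNReal
  have hsum : ∀ᵐ ω ∂P, Summable fun i =>
      (Icc (-T_I) T_E).indicator 1 (X i ω).2 * (1 + ‖(X i ω).1‖ ^ α)⁻¹ * |h i ω| := by
    refine hX.ae_summable_mul_abs hh_meas hh_law hXh
      (f := fun p : SpaceTime => (Icc (-T_I) T_E).indicator 1 p.2 * (1 + ‖p.1‖ ^ α)⁻¹) ?_ ?_ ?_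
    · exact ((measurable_one.indicator measurableSet_Icc).comp measurable_snd).mul
        (Measurable.inv (by fun_prop))
    · exact (integrable_indicator_mul_inv_one_add_norm_rpow hα).smul_measure ENNReal.ofReal_ne_top
    · exact fun p => mul_nonneg (indicator_nonneg (fun _ _ => zero_le_one) _) (by positivity)
  let w : SpaceTime → ℝ := fun p => P₁ * (psi T_I T_E p.2 * (1 + ‖p.1‖ ^ α)⁻¹)
  have hw : Measurable w := (((hpsi.comp measurable_snd).mul
    (Measurable.inv (by fun_prop))).const_mul P₁)
  have hE : ∀ᵐ ω ∂P, Tendsto (fun n => ∑ i ∈ Finset.range n, w (X i ω) * h i ω) atTop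
      (𝓝 (harvestedEnergy P₁ α T_I T_E (fun i => X i ω) (fun i => h i ω))) := by
    filter_upwards [hsum] with ω hω
    exact (hasSum_harvestedEnergy hT_I hT_E hω).tendsto_sum_nat
  have hpart : ∀ n, Measurable fun ω => ∑ i ∈ Finset.range n, w (X i ω) * h i ω := fun n =>
    Finset.measurable_fun_sum _ fun i _ => (hw.comp (hXm i)).mul (hh_meas i)
  have hEm : AEMeasurable
      (fun ω => harvestedEnergy P₁ α T_I T_E (fun i => X i ω) (fun i => h i ω)) P :=
    aemeasurable_of_tendsto_metrizable_ae atTop (fun n => (hpart n).aemeasurable) hE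
  refine ⟨?_, hEm, integral_activity hT_I hT_E, fun z =>
    ⟨fun t => integrableOn_charIntegrand hα z t,
      (integrable_integral_charIntegrand hα hT_I hT_E z).intervalIntegrable, ?_⟩⟩
  · filter_upwards [hsum] with ω hω
    exact ⟨fun t ht => summable_receivedGain hω ht, intervalIntegrable_incidentPower hT_E hω⟩
  -- The exponential characteristic function at `z * w p`: the factor contributed by a point at `p`
  -- once its mark is averaged out.
  let g : SpaceTime → ℂ := fun p => 1 / (1 - Complex.I * (z * w p : ℝ))
  have hg : Measurable g := Measurable.div (by fun_prop) (by fun_prop)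
  have hg_sub : ∀ p, g p - 1 = Complex.I * (z * P₁ * psi T_I T_E p.2 : ℝ) /
      (((1 + ‖p.1‖ ^ α : ℝ) : ℂ) - Complex.I * (z * P₁ * psi T_I T_E p.2 : ℝ)) := by
    intro p
    rw [← inv_one_sub_I_mul_sub_one _ _ (by positivity)]
    simp only [g, w, mul_assoc]
  have hlim : Tendsto (fun n => ∫ ω, ∏ i ∈ Finset.range n, g (X i ω) ∂P) atTop
      (𝓝 (Complex.exp (2 * (Real.pi : ℂ) * (lam₁ : ℂ) *
        ∫ t in (-T_I)..T_E, ∫ u in Ioi (0 : ℝ), charIntegrand P₁ α T_I T_E z t u))) := by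
    have hgi : Integrable (fun p => g p - 1)
        (ENNReal.ofReal lam₁ • (volume : Measure SpaceTime)) := by
      simp only [hg_sub]
      exact (integrable_exponent hα hT_I hT_E z).smul_measure ENNReal.ofReal_ne_top
    convert hX.tendsto_integral_prod hg (fun p => norm_inv_one_sub_I_mul_le _) hgi using 3
    rw [integral_smul_measure]
    simp only [hg_sub]
    rw [integral_exponent hα hT_I hT_E, ENNReal.toReal_ofReal hlam.le, Complex.real_smul]
    ring
  -- The same expectations also converge to the characteristic function of the energy, since the
  -- partial sums converge almost surely and the exponentials have modulus one.
  refine tendsto_nhds_unique ?_ hlim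
  have hfin : ∀ n, ∫ ω, ∏ i ∈ Finset.range n, g (X i ω) ∂P =
      ∫ ω, Complex.exp (Complex.I * (∑ i ∈ Finset.range n, (z * w (X i ω)) * h i ω : ℝ)) ∂P :=
    fun n => (integral_cexp_sum_mul_eq hXm hh_meas hh_law hh_indep hXh (hw.const_mul z) n).symm
  simp only [hfin]
  rw [charFun_apply_real, integral_map hEm (by fun_prop)]
  refine tendsto_integral_of_dominated_convergence (fun _ => (1 : ℝ)) (fun n => ?_)
    (integrable_const 1) (fun n => Eventually.of_forall fun ω => ?_) ?_
  · have : Measurable fun ω => ∑ i ∈ Finset.range n, z * w (X i ω) * h i ω := by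
      simpa only [mul_assoc, ← Finset.mul_sum] using (hpart n).const_mul z
    exact Measurable.aestronglyMeasurable (by fun_prop)
  · rw [mul_comm, Complex.norm_exp_ofReal_mul_I]
  · filter_upwards [hE] with ω hω
    have hc : Continuous fun x : ℝ => Complex.exp (z * x * Complex.I) := by fun_prop
    refine ((hc.tendsto _).comp hω).congr fun n => ?_
    simp only [Function.comp_apply, mul_assoc, ← Finset.mul_sum]
    push_cast
    ring_nf
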